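/- Let $N\ge 2$, let $\Omega\subset\mathbb R^N$ be a bounded open set with Lipschitz boundary, let $T>0$, $u_0\in L^2(\Omega)$ and $f\in L^2((0,T)\times\Omega)$. Consider the problem $$u'-\Delta_1u=f\ \text{ in }(0,T)\times\Omega,\qquad u=0\ \text{ on }(0,T)\times\partial\Omega,\qquad u(0)=u_0 .$$ *Fluxes.* For a vector field $\mathbf z\in L^\infty(\Omega;\mathbb R^N)$ whose distributional divergence is extended to a functional $\langle\operatorname{div}\mathbf z,\cdot\rangle$ on $BV(\Omega)\cap L^2(\Omega)$, and for $v\in BV(\Omega)\cap L^2(\Omega)$, let $(\mathbf z,Dv)$ be the distribution $\langle(\mathbf z,Dv),\omega\rangle=-\langle\operatorname{div}\mathbf z,v\omega\rangle-\int_\Omega v\,\mathbf z\cdot\nabla\omega\,dx$, $\omega\in C_0^\infty(\Omega)$. A function $[\mathbf z,\nu]\in L^\infty(\partial\Omega)$ with $\|[\mathbf z,\nu]\|_\infty\le1$ is the weak normal trace of $\mathbf z$ if, for every $v\in BV(\Omega)\cap L^2(\Omega)$, $(\mathbf z,Dv)$ is a finite Radon measure and Green's formula $$\langle\operatorname{div}\mathbf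 z,v\rangle+\int_\Omega(\mathbf z,Dv)=\int_{\partial\Omega}v\,[\mathbf z,\nu]\,d\mathcal H^{N-1}$$ holds. A flux for $u$ is a field $\mathbf z\in L^\infty((0,T)\times\Omega;\mathbb R^N)$ with $\|\mathbf z\|_\infty\le1$, together with such an extension of $\operatorname{div}\mathbf z(t)$, such that for almost every $t\in(0,T)$ the normal trace $[\mathbf z(t),\nu]$ exists, $(\mathbf z(t),Du(t))=|Du(t)|$ as measures in $\Omega$, and $[\mathbf z(t),\nu]\in\operatorname{sign}(-u(t))$ $\mathcal H^{N-1}$-a.e. on $\partial\Omega$, where $\operatorname{sign}(0)=[-1,1]$. *Solutions.* Let $u\in C([0,T];L^2(\Omega))\cap L^1(0,T;BV(\Omega))$ with $u(0)=u_0$. It is called a solution if one of the following holds. (a) There is a flux $\mathbf z$ for $u$ whose extended divergence $t\mapsto\operatorname{div}\mathbf z(t)$ belongs to $L^1(0,T;BV(\Omega)\cap L^2(\Omega))^*$ (identified with the bounded weakly-$*$ measurable maps from $(0,T)$ to $(BV(\Omega)\cap L^2(\Omega))^*$) and such that, with $\langle\!\langle\xi(t),v\rangle\!\rangle=\langle\operatorname{div}\mathbf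 z(t),v\rangle+\int_\Omega f(t)v\,dx$ (that is, $\xi=\operatorname{div}\mathbf z+f$), $\xi$ is the time derivative of $u$, in the sense that $$\int_0^T\langle\!\langle\xi(t),\Psi(t)\rangle\!\rangle\,dt=-\int_0^T\int_\Omega u\,\Theta\,dx\,dt$$ for every $\Psi\in L^1(0,T;BV(\Omega))\cap L^\infty(0,T;L^2(\Omega))$ with compact support in time and of the form $\Psi(t)=\int_0^t\Theta(s)\,ds$ (Pettis integral in $BV(\Omega)$) with $\Theta$ weakly measurable into $BV(\Omega)$, $\int_0^T\|\Theta(t)\|_{BV(\Omega)}dt<\infty$ and $\Theta\in L^1(0,T;L^2(\Omega))$; and moreover $\langle\!\langle\xi(t),u(t)\rangle\!\rangle=\frac12\bigl(\int_\Omega u(t)^2dx\bigr)'$ in the sense of distributions on $(0,T)$ (with locally integrable left-hand side). (b) $u$ has a distributional time derivative $u'$ with $u'\in L^2((\delta,T)\times\Omega)$ for every $\delta>0$, and there is a flux $\mathbf z$ for $u$ with $\operatorname{div}\mathbf z(t)=u'(t)-f(t)$ for almost every $t$, where $u'(t)-f(t)\in L^2(\Omega)$ acts on $BV(\Omega)\cap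 L^2(\Omega)$ by integration. **Claim.** Let $u$ be a solution, in the sense (a) or (b). Then for almost every $t\in(0,T)$ the quantities below are finite, the function $s\mapsto\int_\Omega u(s)^2dx$ is differentiable at $t$, and $$\frac12\Bigl(\int_\Omega u(t)^2\,dx\Bigr)'=-\int_\Omega|Du(t)|-\int_{\partial\Omega}|u(t)|\,d\mathcal H^{N-1}+\int_\Omega u(t)f(t)\,dx .$$ Moreover, $t\mapsto\int_\Omega u(t)^2\,dx$ is absolutely continuous on $[0,T]$. -/

import Mathlib

open MeasureTheory Set Filter Topology
open scoped ENNReal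

noncomputable section

namespace TVFlow

/-- `ℝᴺ` with its Euclidean norm. -/
abbrev Sp (N : ℕ) : Type := EuclideanSpace ℝ (Fin N)

/-- `φ ∈ C₀^∞(U)`: smooth with compact support contained in `U`. -/
structure IsTest {V : Type*} [NormedAddCommGroup V] [NormedSpace ℝ V] (U : Set V)
    (φ : V → ℝ) : Prop where
  smooth : ContDiff ℝ ((⊤ : ℕ∞) : WithTop ℕ∞) φ
  compact_supp : HasCompactSupport φ
  supp_subset : tsupport φ ⊆ U

variable {N : ℕ}

/-- `∂Ω` is Lipschitz: near each boundary point, in suitable orthonormal coordinates (with last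
axis `e`), the set `Ω` is the part lying strictly above the graph of a Lipschitz function of the
other coordinates. -/
def HasLipschitzBoundary (Ω : Set (Sp N)) : Prop :=
  ∀ x ∈ frontier Ω, ∃ r : ℝ, 0 < r ∧ ∃ e : Sp N, ‖e‖ = 1 ∧
    ∃ (K : NNReal) (γ : Sp N → ℝ), LipschitzWith K γ ∧
      ∀ y ∈ Metric.ball x r, (y ∈ Ω ↔ γ (y - (inner ℝ e y : ℝ) • e) < inner ℝ e y)

/-- The surface measure `ℋ^{N-1}` on `∂Ω`, where `ℋ^{N-1}` is normalised to agree with Lebesgue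
measure on `(N-1)`-dimensional subspaces. -/
def surf (Ω : Set (Sp N)) : Measure (Sp N) :=
  (Measure.euclideanHausdorffMeasure (N - 1)).restrict (frontier Ω)

/-- The `ℝᴺ`-valued measure `D` on `Ω` is the distributional gradient of `v` in `Ω`. -/
structure IsGradMeasure (Ω : Set (Sp N)) (v : Sp N → ℝ) (D : VectorMeasure (Sp N) (Sp N)) :
    Prop where
  concentrated : ∀ A, MeasurableSet A → D A = D (A ∩ Ω)
  ibp : ∀ φ : Sp N → ℝ, IsTest Ω φ →
    ∫ x in Ω, v x • gradient φ x = - (∫ᵛ x, φ x ∂•D)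

/-- `v ∈ BV(Ω)`. (A measure with values in `ℝᴺ` has finite total variation automatically.) -/
def IsBV (Ω : Set (Sp N)) (v : Sp N → ℝ) : Prop :=
  IntegrableOn v Ω ∧ ∃ D : VectorMeasure (Sp N) (Sp N), IsGradMeasure Ω v D

open Classical in
/-- The gradient measure `Dv` of a function of bounded variation. -/
def gradMeasure (Ω : Set (Sp N)) (v : Sp N → ℝ) : VectorMeasure (Sp N) (Sp N) :=
  if h : ∃ D : VectorMeasure (Sp N) (Sp N), IsGradMeasure Ω v D then h.choose else 0

/-- The total variation measure `|Dv|` on `Ω`. -/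
def tv (Ω : Set (Sp N)) (v : Sp N → ℝ) : Measure (Sp N) := (gradMeasure Ω v).variation

/-- The norm `∫_Ω |Dv| + ∫_Ω |v|` of `BV(Ω)`, with values in `[0, ∞]`. -/
def bvNorm (Ω : Set (Sp N)) (v : Sp N → ℝ) : ℝ≥0∞ :=
  tv Ω v Ω + ∫⁻ x in Ω, ‖v x‖ₑ

/-- `v ∈ BV(Ω) ∩ L²(Ω)`. -/
def IsBVL2 (Ω : Set (Sp N)) (v : Sp N → ℝ) : Prop :=
  IsBV Ω v ∧ MemLp v 2 (volume.restrict Ω)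

/-- The trace of `v ∈ BV(Ω)` on `∂Ω`: at `ℋ^{N-1}`-almost every point of the boundary it is the
limit of the averages of `v` over the sets `B(x,r) ∩ Ω`, as `r ↓ 0`. -/
def bvTrace (Ω : Set (Sp N)) (v : Sp N → ℝ) (x : Sp N) : ℝ :=
  limUnder (𝓝[>] (0 : ℝ)) (fun r => ⨍ y in Metric.ball x r ∩ Ω, v y)

/-- The distribution `(z, Dv)`, evaluated at `ω`:
`⟨(z, Dv), ω⟩ = - ⟨div z, v ω⟩ - ∫_Ω v z · ∇ω`. Here `d` is the functional `⟨div z, ·⟩`, the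
divergence of `z` extended to `BV(Ω) ∩ L²(Ω)`. -/
def pairing (Ω : Set (Sp N)) (z : Sp N → Sp N) (d : (Sp N → ℝ) → ℝ) (v ω : Sp N → ℝ) : ℝ :=
  - d (fun x => v x * ω x) - ∫ x in Ω, v x * inner ℝ (z x) (gradient ω x)

/-- The distribution `(z, Dv)` is the finite signed Radon measure `μ` on `Ω`. -/
structure IsPairingMeasure (Ω : Set (Sp N)) (z : Sp N → Sp N) (d : (Sp N → ℝ) → ℝ)
    (v : Sp N → ℝ) (μ : SignedMeasure (Sp N)) : Prop where
  concentrated : ∀ A, MeasurableSet A → μ A = μ (A ∩ Ω)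
  repr : ∀ ω : Sp N → ℝ, IsTest Ω ω → (∫ᵛ x, ω x ∂<•μ) = pairing Ω z d v ω

/-- `g = [z, ν]` is the weak trace on `∂Ω` of the normal component of `z`, with `‖[z, ν]‖_∞ ≤ 1`:
for every `v ∈ BV(Ω) ∩ L²(Ω)` the distribution `(z, Dv)` is a Radon measure, and Green's formula
`⟨div z, v⟩ + ∫_Ω (z, Dv) = ∫_{∂Ω} v [z, ν] dℋ^{N-1}` holds. -/
structure IsNormalTrace (Ω : Set (Sp N)) (z : Sp N → Sp N) (d : (Sp N → ℝ) → ℝ)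
    (g : Sp N → ℝ) : Prop where
  meas : AEStronglyMeasurable g (surf Ω)
  bound : ∀ᵐ x ∂(surf Ω), |g x| ≤ 1
  green : ∀ v : Sp N → ℝ, IsBVL2 Ω v → ∃ μ : SignedMeasure (Sp N),
    IsPairingMeasure Ω z d v μ ∧ Integrable (fun x => bvTrace Ω v x * g x) (surf Ω) ∧
      d v + μ Ω = ∫ x, bvTrace Ω v x * g x ∂(surf Ω)

/-- `s ∈ sign(a)`, for the multivalued sign with `sign(0) = [-1, 1]`. -/
def InSign (s a : ℝ) : Prop :=
  (0 < a → s = 1) ∧ (a < 0 → s = -1) ∧ |s| ≤ 1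

/-- `L²(Ω)`. -/
abbrev L2 (Ω : Set (Sp N)) : Type := Lp ℝ 2 (volume.restrict Ω : Measure (Sp N))

/-- Lebesgue measure on `(a, b) × Ω`. -/
def cyl (a b : ℝ) (Ω : Set (Sp N)) : Measure (ℝ × Sp N) :=
  (volume.restrict (Ioo a b)).prod (volume.restrict Ω)

/-- `u ∈ C([0,T]; L²(Ω)) ∩ L¹(0,T; BV(Ω))` with `u(0) = u₀`. -/
structure IsPath (Ω : Set (Sp N)) (T : ℝ) (u₀ : L2 Ω) (u : ℝ → L2 Ω) : Prop where
  cont : ContinuousOn u (Icc 0 T)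
  bv : ∀ᵐ t ∂(volume.restrict (Ioo 0 T)), IsBV Ω (u t)
  bv_int : ∫⁻ t in Ioo 0 T, bvNorm Ω (u t) < ∞
  init : u 0 = u₀

/-- `z` plays the role of `Du/|Du|`: `z ∈ L^∞((0,T)×Ω; ℝᴺ)`, `‖z‖_∞ ≤ 1`, and for almost every `t`
the functional `d t = ⟨div z(t), ·⟩` extends the distributional divergence of `z(t)`, the normal
trace `[z(t), ν]` exists with Green's formula, `[z(t), ν] ∈ sign(-u(t))` holds `ℋ^{N-1}`-a.e. on
`∂Ω`, and `(z(t), Du(t)) = |Du(t)|` as measures in `Ω`. -/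
structure IsFlux (Ω : Set (Sp N)) (T : ℝ) (u : ℝ → L2 Ω) (z : ℝ → Sp N → Sp N)
    (d : ℝ → (Sp N → ℝ) → ℝ) : Prop where
  meas : AEStronglyMeasurable (Function.uncurry z) (cyl 0 T Ω)
  bound : ∀ᵐ p ∂(cyl 0 T Ω), ‖z p.1 p.2‖ ≤ 1
  div : ∀ᵐ t ∂(volume.restrict (Ioo 0 T)), ∀ ω : Sp N → ℝ, IsTest Ω ω →
    d t ω = - ∫ x in Ω, inner ℝ (z t x) (gradient ω x)
  trace : ∀ᵐ t ∂(volume.restrict (Ioo 0 T)), ∃ g : Sp N → ℝ, IsNormalTrace Ω (z t) (d t) g ∧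
    ∀ᵐ x ∂(surf Ω), InSign (g x) (- bvTrace Ω (u t) x)
  eq_tv : ∀ᵐ t ∂(volume.restrict (Ioo 0 T)), ∀ ω : Sp N → ℝ, IsTest Ω ω →
    pairing Ω (z t) (d t) (u t) ω = ∫ x, ω x ∂(tv Ω (u t))

/-- `d ∈ L¹(0,T; BV(Ω) ∩ L²(Ω))*`, identified with the space of bounded weakly-* measurable maps
from `(0,T)` to the dual of `BV(Ω) ∩ L²(Ω)`. -/
structure IsDualElement (Ω : Set (Sp N)) (T : ℝ) (d : ℝ → (Sp N → ℝ) → ℝ) : Prop where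
  add : ∀ᵐ t ∂(volume.restrict (Ioo 0 T)), ∀ v w : Sp N → ℝ, IsBVL2 Ω v → IsBVL2 Ω w →
    d t (v + w) = d t v + d t w
  smul : ∀ᵐ t ∂(volume.restrict (Ioo 0 T)), ∀ (c : ℝ) (v : Sp N → ℝ), IsBVL2 Ω v →
    d t (c • v) = c * d t v
  bound : ∃ C : ℝ, ∀ᵐ t ∂(volume.restrict (Ioo 0 T)), ∀ v : Sp N → ℝ, IsBVL2 Ω v →
    |d t v| ≤ C * max (bvNorm Ω v).toReal (eLpNorm v 2 (volume.restrict Ω)).toReal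
  meas : ∀ v : Sp N → ℝ, IsBVL2 Ω v →
    AEMeasurable (fun t => d t v) (volume.restrict (Ioo 0 T))

/-- `ℓ` is a bounded linear functional on `BV(Ω)`. -/
structure IsBVFunctional (Ω : Set (Sp N)) (l : (Sp N → ℝ) → ℝ) : Prop where
  add : ∀ v w : Sp N → ℝ, IsBV Ω v → IsBV Ω w → l (v + w) = l v + l w
  smul : ∀ (c : ℝ) (v : Sp N → ℝ), IsBV Ω v → l (c • v) = c * l v
  bound : ∃ C : ℝ, ∀ v : Sp N → ℝ, IsBV Ω v → |l v| ≤ C * (bvNorm Ω v).toReal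

/-- `Ψ ∈ L¹(0,T; BV(Ω)) ∩ L^∞(0,T; L²(Ω))` has the weak derivative
`Θ ∈ L¹_w(0,T; BV(Ω)) ∩ L¹(0,T; L²(Ω))`, that is, `Ψ(t) = ∫₀ᵗ Θ(s) ds` as a Pettis integral in
`BV(Ω)`. -/
structure HasWeakDeriv (Ω : Set (Sp N)) (T : ℝ) (Ψ Θ : ℝ → Sp N → ℝ) : Prop where
  meas : AEStronglyMeasurable (Function.uncurry Ψ) (cyl 0 T Ω)
  bv : ∀ t ∈ Icc 0 T, IsBV Ω (Ψ t)
  bv_int : ∫⁻ t in Ioo 0 T, bvNorm Ω (Ψ t) < ∞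
  l2 : ∃ C : NNReal, ∀ᵐ t ∂(volume.restrict (Ioo 0 T)),
    eLpNorm (Ψ t) 2 (volume.restrict Ω) ≤ C
  deriv_meas : AEStronglyMeasurable (Function.uncurry Θ) (cyl 0 T Ω)
  deriv_bv : ∀ᵐ t ∂(volume.restrict (Ioo 0 T)), IsBV Ω (Θ t)
  deriv_weak_meas : ∀ l, IsBVFunctional Ω l →
    AEMeasurable (fun t => l (Θ t)) (volume.restrict (Ioo 0 T))
  deriv_bv_int : ∫⁻ t in Ioo 0 T, bvNorm Ω (Θ t) < ∞
  deriv_l2_int : ∫⁻ t in Ioo 0 T, eLpNorm (Θ t) 2 (volume.restrict Ω) < ∞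
  pettis : ∀ l, IsBVFunctional Ω l → IntegrableOn (fun s => l (Θ s)) (Ioo 0 T) ∧
    ∀ t ∈ Icc 0 T, l (Ψ t) = ∫ s in Ioo 0 t, l (Θ s)

/-- `⟨⟨ξ, v⟩⟩_Ω = ⟨d, v⟩_Ω + ∫_Ω f v`, for `ξ = d + f`. -/
def dpair (Ω : Set (Sp N)) (d : (Sp N → ℝ) → ℝ) (f v : Sp N → ℝ) : ℝ :=
  d v + ∫ x in Ω, f x * v x

/-- `ξ = d + f` is the time derivative of `u`: for every `Ψ` with compact support in time which has
a weak derivative `Θ`, one has `∫₀ᵀ ⟨⟨ξ(t), Ψ(t)⟩⟩ dt = - ∫₀ᵀ ∫_Ω u(t) Θ(t) dx dt`. -/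
def IsTimeDerivative (Ω : Set (Sp N)) (T : ℝ) (u : ℝ → L2 Ω) (d : ℝ → (Sp N → ℝ) → ℝ)
    (f : ℝ → Sp N → ℝ) : Prop :=
  ∀ Ψ Θ : ℝ → Sp N → ℝ, HasWeakDeriv Ω T Ψ Θ →
    (∃ a b : ℝ, 0 < a ∧ b < T ∧ ∀ t ∈ Icc 0 T, t ∉ Icc a b → Ψ t =ᵐ[volume.restrict Ω] 0) →
    IntegrableOn (fun t => dpair Ω (d t) (f t) (Ψ t)) (Ioo 0 T) ∧
      ∫ t in Ioo 0 T, dpair Ω (d t) (f t) (Ψ t) =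
        - ∫ t in Ioo 0 T, ∫ x in Ω, u t x * Θ t x

/-- Solutions of `u' - Δ₁ u = f` in `(0,T) × Ω`, `u = 0` on `(0,T) × ∂Ω`, `u(0) = u₀`, in the
general sense: `ξ = div z + f` is the time derivative of `u`, and
`⟨⟨ξ(t), u(t)⟩⟩ = ½ (∫_Ω u(t)²)'` in the sense of distributions on `(0,T)`. -/
def IsSolution (Ω : Set (Sp N)) (T : ℝ) (f : ℝ → Sp N → ℝ) (u₀ : L2 Ω) (u : ℝ → L2 Ω) : Prop :=
  IsPath Ω T u₀ u ∧ ∃ (z : ℝ → Sp N → Sp N) (d : ℝ → (Sp N → ℝ) → ℝ),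
    IsDualElement Ω T d ∧ IsFlux Ω T u z d ∧ IsTimeDerivative Ω T u d f ∧
    LocallyIntegrableOn (fun t => dpair Ω (d t) (f t) (u t)) (Ioo 0 T) ∧
    ∀ η : ℝ → ℝ, IsTest (Ioo 0 T) η →
      - ∫ t in Ioo 0 T, deriv η t * ((1 / 2) * ∫ x in Ω, (u t x) ^ 2) =
        ∫ t in Ioo 0 T, η t * dpair Ω (d t) (f t) (u t)

/-- Solutions of the same problem in the sense of the theory for sources `f ∈ L²((0,T) × Ω)`:
`u` has a distributional time derivative `w = u'` with `w ∈ L²((δ,T) × Ω)` for every `δ > 0`, and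
`div z(t) = w(t) - f(t)` is a function in `L²(Ω)` for almost every `t`, acting on `BV(Ω) ∩ L²(Ω)`
by integration. Nothing is required of `t ↦ ∫_Ω u(t)²`. -/
def IsStrongSolution (Ω : Set (Sp N)) (T : ℝ) (f : ℝ → Sp N → ℝ) (u₀ : L2 Ω) (u : ℝ → L2 Ω) :
    Prop :=
  IsPath Ω T u₀ u ∧ ∃ (z : ℝ → Sp N → Sp N) (w : ℝ → Sp N → ℝ),
    (∀ δ : ℝ, 0 < δ → MemLp (Function.uncurry w) 2 (cyl δ T Ω)) ∧
    (∀ (η : ℝ → ℝ) (ω : Sp N → ℝ), IsTest (Ioo 0 T) η → IsTest Ω ω →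
      ∫ t in Ioo 0 T, deriv η t * ∫ x in Ω, u t x * ω x =
        - ∫ t in Ioo 0 T, η t * ∫ x in Ω, w t x * ω x) ∧
    IsFlux Ω T u z (fun t v => ∫ x in Ω, (w t x - f t x) * v x)

end TVFlow

end

namespace TVFlow

/-! At a fixed time, Green's formula is tested with `u(t)` itself. Since `(z, Du) = |Du|` and the
sign condition turns the boundary integrand into `-|u|`, it gives `⟨div z, u⟩ = -|Du|(Ω) - ∫_{∂Ω}
|u|` (`IsNormalTrace.div_apply_eq`). What remains is that `h = ⟨⟨div z + f, u⟩⟩` is the derivative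
of `G = ½ ∫ u²`, first on compact subintervals of `(0,T)`.

In sense (a) this is the assumed distributional identity, and `G` is continuous, so `G` is a
primitive of `h` by the du Bois-Reymond lemma (`sub_eq_integral_of_weakDeriv`). In sense (b), `h = ∫
u' u`, and the chain rule in `L²` is needed (`half_norm_sq_sub_eq_integral`): increments of `u` are
controlled by `∫ ‖u'‖`, so `G` is absolutely continuous, and its derivative is found a.e. by testing
`u` against a countable dense set.

The endpoints come from dissipation: the total variation and boundary terms have a sign, so `h` has
the integrable majorant `½ ∫ u² + ½ ∫ f²`. As `G` is bounded, this one-sided bound already makes `h`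
integrable on `(0,T)` (`hasDerivAt_and_absolutelyContinuous_of_le`). -/

/-! ### Weak derivatives and absolute continuity on an interval. -/

theorem absolutelyContinuousOnInterval_of_dist_le {X Y : Type*} [PseudoMetricSpace X]
    [PseudoMetricSpace Y] {f : ℝ → X} {g : ℝ → Y} {a b M : ℝ}
    (hg : AbsolutelyContinuousOnInterval g a b)
    (h : ∀ x ∈ uIcc a b, ∀ y ∈ uIcc a b, dist (f x) (f y) ≤ M * dist (g x) (g y)) :
    AbsolutelyContinuousOnInterval f a b := by
  have hM := Tendsto.const_mul M hg
  rw [mul_zero] at hM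
  refine squeeze_zero' (Eventually.of_forall fun E => Finset.sum_nonneg fun _ _ => dist_nonneg)
    ?_ hM
  refine eventually_inf_principal.2 (Eventually.of_forall fun E hE => ?_)
  rw [Finset.mul_sum]
  refine Finset.sum_le_sum fun i hi => ?_
  exact h _ (hE.1 i hi).1 _ (hE.1 i hi).2

/-- The antiderivative of a test function of vanishing integral is a test function. -/
theorem IsTest.exists_antideriv {a b : ℝ} {ψ : ℝ → ℝ} (hψ : IsTest (Ioo a b) ψ)
    (h0 : ∫ x, ψ x = 0) : ∃ η : ℝ → ℝ, IsTest (Ioo a b) η ∧ deriv η = ψ := by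
  have hc : Continuous ψ := hψ.smooth.continuous
  have hd : ∀ x, HasDerivAt (fun x => ∫ y in a..x, ψ y) (ψ x) x := fun x =>
    intervalIntegral.integral_hasDerivAt_right (hc.intervalIntegrable _ _)
      hc.aestronglyMeasurable.stronglyMeasurableAtFilter hc.continuousAt
  have hderiv : deriv (fun x => ∫ y in a..x, ψ y) = ψ := funext fun x => (hd x).deriv
  obtain ⟨a', b', ha', hb', hsub⟩ : ∃ a' b', a < a' ∧ b' < b ∧ tsupport ψ ⊆ Icc a' b' := by
    rcases (tsupport ψ).eq_empty_or_nonempty with he | hne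
    -- With empty support any values inside the strict bounds will do; `a' ≤ b'` is never needed.
    · exact ⟨a + 1, b - 1, by linarith, by linarith, by simp [he]⟩
    · obtain ⟨p, hp⟩ := hψ.compact_supp.exists_isLeast hne
      obtain ⟨q, hq⟩ := hψ.compact_supp.exists_isGreatest hne
      exact ⟨p, q, (hψ.supp_subset hp.1).1, (hψ.supp_subset hq.1).2,
        fun x hx => ⟨hp.2 hx, hq.2 hx⟩⟩
  have hz : ∀ x, x ∉ Icc a' b' → ψ x = 0 := fun x hx =>
    image_eq_zero_of_notMem_tsupport fun h => hx (hsub h)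
  have hz' : ∀ x, x ∉ Icc a' b' → ∫ y in a..x, ψ y = 0 := by
    intro x hx
    rcases lt_or_ge x a' with h | h
    · refine (intervalIntegral.integral_congr fun y hy => ?_).trans
        intervalIntegral.integral_zero
      refine hz y fun hy' => ?_
      have := hy.2
      have h2 : max a x < a' := max_lt ha' h
      exact absurd hy'.1 (not_le.2 (lt_of_le_of_lt this h2))
    · have hxb : b' < x := by
        by_contra hcon
        exact hx ⟨h, not_lt.1 hcon⟩
      rw [intervalIntegral.integral_of_le (ha'.le.trans h), ← h0,
        setIntegral_eq_integral_of_forall_compl_eq_zero]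
      intro y hy
      refine hz y fun hy' => hy ⟨lt_of_lt_of_le ha' hy'.1, hy'.2.trans hxb.le⟩
  have hts : tsupport (fun x => ∫ y in a..x, ψ y) ⊆ Icc a' b' :=
    closure_minimal (fun x hx => by_contra fun hx' => hx (hz' x hx')) isClosed_Icc
  refine ⟨fun x => ∫ y in a..x, ψ y, ⟨?_, ?_, ?_⟩, hderiv⟩
  · rw [contDiff_infty_iff_deriv]
    exact ⟨fun x => (hd x).differentiableAt, by rw [hderiv]; exact hψ.smooth⟩
  · exact isCompact_Icc.of_isClosed_subset (isClosed_tsupport _) hts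
  · exact hts.trans fun x hx => ⟨ha'.trans_le hx.1, hx.2.trans_lt hb'⟩

theorem IsTest.eq_zero {V : Type*} [NormedAddCommGroup V] [NormedSpace ℝ V] {U : Set V}
    {φ : V → ℝ} (hφ : IsTest U φ) {x : V} (hx : x ∉ U) : φ x = 0 :=
  image_eq_zero_of_notMem_tsupport fun h => hx (hφ.supp_subset h)

theorem IsTest.deriv_eq_zero {U : Set ℝ} {φ : ℝ → ℝ} (hφ : IsTest U φ) {x : ℝ} (hx : x ∉ U) :
    deriv φ x = 0 :=
  by_contra fun h => hx (hφ.supp_subset (support_deriv_subset h))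

/-- A continuous function whose distributional derivative is integrable is a primitive of it. -/
theorem sub_eq_integral_of_weakDeriv {a b : ℝ} (hab : a < b) {G h : ℝ → ℝ}
    (hG : ContinuousOn G (Icc a b)) (hh : IntervalIntegrable h volume a b)
    (H : ∀ η, IsTest (Ioo a b) η →
      ∫ x in a..b, deriv η x * G x = - ∫ x in a..b, η x * h x) :
    G b - G a = ∫ x in a..b, h x := by
  have hac := hh.absolutelyContinuousOnInterval_intervalIntegral (c := a) (by simp)
  set P : ℝ → ℝ := fun x => ∫ v in a..x, h v with hP
  have hPc : ContinuousOn P (Icc a b) := by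
    have := hac.continuousOn
    rwa [uIcc_of_le hab.le] at this
  have hDc : ContinuousOn (fun x => G x - P x) (Icc a b) := hG.sub hPc
  -- The primitive `P` satisfies the same weak identity as `G`, by integration by parts for
  -- absolutely continuous functions, so `G - P` has zero weak derivative.
  have key : ∀ η, IsTest (Ioo a b) η → ∫ x in a..b, deriv η x * (G x - P x) = 0 := by
    intro η hη
    have hηac : AbsolutelyContinuousOnInterval η a b := by
      have h1 : IntervalIntegrable (deriv η) volume a b :=
        (hη.smooth.continuous_deriv (by simp)).intervalIntegrable _ _
      refine absolutelyContinuousOnInterval_of_dist_le (M := 1)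
        (h1.absolutelyContinuousOnInterval_intervalIntegral (c := a) (by simp)) ?_
      intro x _ y _
      have e : ∀ x, ∫ v in a..x, deriv η v = η x - η a := fun x =>
        intervalIntegral.integral_deriv_eq_sub
          (fun z _ => (hη.smooth.differentiable (by simp)) z)
          ((hη.smooth.continuous_deriv (by simp)).intervalIntegrable _ _)
      simp [e]
    have ibp := hac.integral_mul_deriv_eq_deriv_mul hηac
    rw [hη.eq_zero (by simp : a ∉ Ioo a b), hη.eq_zero (by simp : b ∉ Ioo a b)] at ibp
    have hder : ∫ x in a..b, deriv P x * η x = ∫ x in a..b, η x * h x := by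
      refine intervalIntegral.integral_congr_ae ?_
      filter_upwards [hh.ae_hasDerivAt_integral] with x hx hx'
      rw [(hx (uIoc_subset_uIcc hx') a (by simp)).deriv, mul_comm]
    have hηi : ContinuousOn (deriv η) (uIcc a b) :=
      (hη.smooth.continuous_deriv (by simp)).continuousOn
    simp_rw [mul_sub]
    rw [intervalIntegral.integral_sub, H η hη]
    · simp_rw [mul_comm (deriv η _) (P _)]
      rw [ibp, hder]
      ring
    · exact (hηi.mul (by rwa [uIcc_of_le hab.le])).intervalIntegrable
    · exact (hηi.mul (by rwa [uIcc_of_le hab.le])).intervalIntegrable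
  -- Subtracting `(∫ g) ρ` makes any test function `g` mean-free, hence the derivative of a test
  -- function. So `G - P` equals its `ρ`-average `c` a.e., and everywhere by continuity.
  obtain ⟨ρ, hρ, hρ1⟩ : ∃ ρ : ℝ → ℝ, IsTest (Ioo a b) ρ ∧ ∫ x, ρ x = 1 := by
    let B : ContDiffBump ((a + b) / 2) :=
      { rIn := (b - a) / 8, rOut := (b - a) / 4, rIn_pos := by linarith, rIn_lt_rOut := by linarith }
    refine ⟨B.normed volume, ⟨B.contDiff_normed, B.hasCompactSupport_normed, ?_⟩,
      B.integral_normed⟩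
    rw [B.tsupport_normed_eq, Real.closedBall_eq_Icc]
    rintro x ⟨h1, h2⟩
    simp only [B] at h1 h2
    constructor <;> linarith
  set c := ∫ x in a..b, ρ x * (G x - P x) with hc
  have hae : ∀ᵐ x, x ∈ Ioo a b → (G x - P x - c) = 0 := by
    refine isOpen_Ioo.ae_eq_zero_of_integral_contDiff_smul_eq_zero ?_ ?_
    · exact ((hDc.sub continuousOn_const).mono Ioo_subset_Icc_self).locallyIntegrableOn
        measurableSet_Ioo
    · intro g hg1 hg2 hg3
      have hg : IsTest (Ioo a b) g := ⟨hg1, hg2, hg3⟩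
      have hgi : Integrable g := hg1.continuous.integrable_of_hasCompactSupport hg2
      have hρi : Integrable ρ :=
        hρ.smooth.continuous.integrable_of_hasCompactSupport hρ.compact_supp
      have hψ : IsTest (Ioo a b) (fun x => g x - (∫ y, g y) * ρ x) := by
        refine ⟨hg1.sub (contDiff_const.mul hρ.smooth), hg2.sub hρ.compact_supp.mul_left, ?_⟩
        refine (tsupport_sub g _).trans (union_subset hg3 ?_)
        exact (tsupport_mul_subset_right).trans hρ.supp_subset
      obtain ⟨η, hη, hη'⟩ := hψ.exists_antideriv (by
        rw [integral_sub hgi (hρi.const_mul _), integral_const_mul, hρ1, mul_one, sub_self])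
      have k := key η hη
      rw [hη'] at k
      have hii : ∀ p : ℝ → ℝ, Continuous p →
          IntervalIntegrable (fun x => p x * (G x - P x)) volume a b := fun p hp =>
        (hp.continuousOn.mul (by rwa [uIcc_of_le hab.le])).intervalIntegrable
      have e1 : ∫ x, g x • (G x - P x - c) = ∫ x in a..b, g x * (G x - P x - c) := by
        rw [intervalIntegral.integral_of_le hab.le,
          setIntegral_eq_integral_of_forall_compl_eq_zero]
        · simp
        · intro x hx
          rw [hg.eq_zero fun h => hx (Ioo_subset_Ioc_self h), zero_mul]
      have e2 : ∫ x, g x = ∫ x in a..b, g x := by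
        rw [intervalIntegral.integral_of_le hab.le,
          setIntegral_eq_integral_of_forall_compl_eq_zero]
        intro x hx
        exact hg.eq_zero fun h => hx (Ioo_subset_Ioc_self h)
      have e3 : ∫ x in a..b, (g x - (∫ y, g y) * ρ x) * (G x - P x) =
          (∫ x in a..b, g x * (G x - P x)) - (∫ y, g y) * c := by
        rw [hc, ← intervalIntegral.integral_const_mul, ← intervalIntegral.integral_sub
          (hii g hg1.continuous) ((hii ρ hρ.smooth.continuous).const_mul _)]
        refine intervalIntegral.integral_congr fun x _ => ?_
        ring
      rw [e1]
      simp_rw [mul_sub (g _) _ c]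
      rw [intervalIntegral.integral_sub (hii g hg1.continuous)
        ((hg1.continuous.intervalIntegrable _ _).mul_const c),
        intervalIntegral.integral_mul_const, ← e2, ← e3, k]
  have heq : EqOn (fun x => G x - P x) (fun _ => c) (Icc a b) := by
    have h1 : EqOn (fun x => G x - P x) (fun _ => c) (Ioo a b) := by
      refine Measure.eqOn_open_of_ae_eq (μ := volume) ?_ isOpen_Ioo
        (hDc.mono Ioo_subset_Icc_self) continuousOn_const
      rw [EventuallyEq, ae_restrict_iff' measurableSet_Ioo]
      filter_upwards [hae] with x hx hx'
      exact sub_eq_zero.1 (hx hx')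
    exact h1.of_subset_closure hDc continuousOn_const Ioo_subset_Icc_self
      (by rw [closure_Ioo hab.ne])
  have hA := heq (left_mem_Icc.2 hab.le)
  have hB := heq (right_mem_Icc.2 hab.le)
  simp only [hP, intervalIntegral.integral_same] at hA hB
  linarith

theorem LocallyIntegrableOn.intervalIntegrable_of_Ioo {h : ℝ → ℝ} {T a b : ℝ}
    (hh : LocallyIntegrableOn h (Ioo 0 T)) (ha : 0 < a) (hab : a ≤ b) (hb : b < T) :
    IntervalIntegrable h volume a b := by
  rw [intervalIntegrable_iff_integrableOn_Icc_of_le hab]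
  exact hh.integrableOn_compact_subset (fun x hx => ⟨ha.trans_le hx.1, hx.2.trans_lt hb⟩)
    isCompact_Icc

/-- Test functions on `(a,b)` are also test functions on `(0,T)`, so the weak identity localises and
only integrability of `h` near `[a,b]` matters. -/
theorem sub_eq_integral_of_weakDeriv_Ioo {T : ℝ} {G h : ℝ → ℝ} (hG : ContinuousOn G (Ioo 0 T))
    {a b : ℝ} (ha : 0 < a) (hab : a ≤ b) (hb : b < T) (hh : IntervalIntegrable h volume a b)
    (H : ∀ η, IsTest (Ioo 0 T) η →
      ∫ t in Ioo 0 T, deriv η t * G t = - ∫ t in Ioo 0 T, η t * h t) :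
    G b - G a = ∫ x in a..b, h x := by
  rcases hab.eq_or_lt with rfl | hab
  · simp
  have hsub : Ioc a b ⊆ Ioo 0 T := fun x hx => ⟨ha.trans hx.1, hx.2.trans_lt hb⟩
  refine sub_eq_integral_of_weakDeriv hab
    (hG.mono fun x hx => ⟨ha.trans_le hx.1, hx.2.trans_lt hb⟩) hh fun η hη => ?_
  have := H η ⟨hη.smooth, hη.compact_supp,
    hη.supp_subset.trans (Ioo_subset_Ioc_self.trans hsub)⟩
  have e1 := setIntegral_eq_of_subset_of_forall_sdiff_eq_zero (μ := volume)
    (f := fun x => deriv η x * G x) measurableSet_Ioo hsub fun x hx => by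
      rw [hη.deriv_eq_zero fun h => hx.2 (Ioo_subset_Ioc_self h), zero_mul]
  have e2 := setIntegral_eq_of_subset_of_forall_sdiff_eq_zero (μ := volume)
    (f := fun x => η x * h x) measurableSet_Ioo hsub fun x hx => by
      rw [hη.eq_zero fun h => hx.2 (Ioo_subset_Ioc_self h), zero_mul]
  rw [intervalIntegral.integral_of_le hab.le, intervalIntegral.integral_of_le hab.le,
    ← e1, ← e2, this]

/-- A continuous function on `[0, T]` that is locally absolutely continuous in the interior and
whose derivative has an integrable majorant is absolutely continuous on `[0, T]`. -/
theorem hasDerivAt_and_absolutelyContinuous_of_le {T : ℝ} (hT : 0 < T) {G h k : ℝ → ℝ}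
    (hG : ContinuousOn G (Icc 0 T)) (hk : IntegrableOn k (Ioo 0 T))
    (hint : ∀ a b, 0 < a → a ≤ b → b < T →
      IntervalIntegrable h volume a b ∧ G b - G a = ∫ x in a..b, h x)
    (hle : ∀ᵐ t ∂(volume.restrict (Ioo 0 T)), h t ≤ k t) :
    (∀ᵐ t ∂(volume.restrict (Ioo 0 T)), HasDerivAt G (h t) t) ∧
      AbsolutelyContinuousOnInterval G 0 T := by
  obtain ⟨M, hM⟩ := isCompact_Icc.exists_bound_of_continuousOn hG
  have hk' : IntegrableOn k (Ioc 0 T) := by rwa [integrableOn_Ioc_iff_integrableOn_Ioo]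
  -- The shift by 3 gives `a n ≤ T / 3`, so `[a n, T - a n]` is a genuine subinterval for every `n`.
  let a : ℕ → ℝ := fun n => T / (n + 3)
  have ha0 : ∀ n, 0 < a n := fun n => by positivity
  have haT : ∀ n, a n ≤ T / 3 := fun n => by
    refine div_le_div_of_nonneg_left hT.le (by norm_num) ?_
    have : (0 : ℝ) ≤ n := Nat.cast_nonneg n
    linarith
  have hat : Tendsto a atTop (𝓝 0) :=
    Tendsto.div_atTop tendsto_const_nhds
      (tendsto_atTop_add_const_right _ _ tendsto_natCast_atTop_atTop)
  have hbt : Tendsto (fun n => T - a n) atTop (𝓝 T) := by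
    simpa using tendsto_const_nhds.sub hat
  -- Since `k - h ≥ 0`, its `L¹` norm on `(a n, T - a n]` is `∫ k` minus an increment of `G`, which
  -- is at most `∫ ‖k‖ + 2M` uniformly in `n`.
  have hq : IntegrableOn (fun x => k x - h x) (Ioc 0 T) := by
    have hsub : ∀ n, Ioc (a n) (T - a n) ⊆ Ioc 0 T := fun n x hx =>
      ⟨(ha0 n).trans hx.1, hx.2.trans (by linarith [ha0 n])⟩
    have hhi : ∀ n, IntervalIntegrable h volume (a n) (T - a n) := fun n =>
      (hint _ _ (ha0 n) (by linarith [haT n]) (by linarith [ha0 n])).1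
    have hhi' : ∀ n, IntegrableOn h (Ioc (a n) (T - a n)) := fun n =>
      (intervalIntegrable_iff_integrableOn_Ioc_of_le (by linarith [haT n])).1 (hhi n)
    refine integrableOn_Ioc_of_intervalIntegral_norm_bounded
      (I := (∫ x in Ioc 0 T, ‖k x‖) + 2 * M) (fun n => (hk'.mono_set (hsub n)).sub (hhi' n))
      hat hbt (Eventually.of_forall fun n => ?_)
    have hae : ∀ᵐ x ∂(volume.restrict (Ioc (a n) (T - a n))), ‖k x - h x‖ = k x - h x := by
      have hs : Ioc (a n) (T - a n) ⊆ Ioo 0 T := fun x hx =>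
        ⟨(ha0 n).trans hx.1, hx.2.trans_lt (by linarith [ha0 n])⟩
      filter_upwards [ae_restrict_of_ae_restrict_of_subset hs hle] with x hx
      exact Real.norm_of_nonneg (sub_nonneg.2 hx)
    rw [integral_congr_ae hae, integral_sub (hk'.mono_set (hsub n)) (hhi' n),
      ← intervalIntegral.integral_of_le (f := h) (by linarith [haT n]),
      ← (hint _ _ (ha0 n) (by linarith [haT n]) (by linarith [ha0 n])).2]
    have h1 : ∫ x in Ioc (a n) (T - a n), k x ≤ ∫ x in Ioc 0 T, ‖k x‖ :=
      (integral_mono (hk'.mono_set (hsub n)) (hk'.mono_set (hsub n)).norm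
        fun x => Real.le_norm_self _).trans
        (setIntegral_mono_set hk'.norm (Eventually.of_forall fun x => norm_nonneg _)
          (hsub n).eventuallyLE)
    have h2 := hM (a n) ⟨(ha0 n).le, by linarith [haT n]⟩
    have h3 := hM (T - a n) ⟨by linarith [haT n], by linarith [ha0 n]⟩
    rw [Real.norm_eq_abs, abs_le] at h2 h3
    linarith [h2.2, h3.1]
  have hh : IntervalIntegrable h volume 0 T := by
    rw [intervalIntegrable_iff_integrableOn_Ioc_of_le hT.le]
    refine (hk'.sub hq).congr (Eventually.of_forall fun x => ?_)
    simp
  have hac := hh.absolutelyContinuousOnInterval_intervalIntegral (c := 0) (by simp)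
  have hPc := hac.continuousOn
  rw [uIcc_of_le hT.le] at hPc
  have hDc := hG.sub hPc
  have hii : ∀ x ∈ Icc 0 T, IntervalIntegrable h volume 0 x := fun x hx =>
    hh.mono_set (by rw [uIcc_of_le hx.1, uIcc_of_le hT.le]; exact Icc_subset_Icc_right hx.2)
  have hopen : ∀ x ∈ Ioo 0 T, ∀ y ∈ Ioo 0 T, x ≤ y →
      G x - (∫ v in 0..x, h v) = G y - ∫ v in 0..y, h v := by
    intro x hx y hy hxy
    have e1 := (hint x y hx.1 hxy hy.2).2
    have e2 := intervalIntegral.integral_add_adjacent_intervals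
      (hii x (Ioo_subset_Icc_self hx)) (hint x y hx.1 hxy hy.2).1
    linarith
  have heq : EqOn (fun x => G x - ∫ v in 0..x, h v)
      (fun _ => G (T / 2) - ∫ v in 0..(T / 2), h v) (Icc 0 T) := by
    refine EqOn.of_subset_closure (s := Ioo 0 T) ?_ hDc continuousOn_const Ioo_subset_Icc_self
      (by rw [closure_Ioo hT.ne])
    intro x hx
    rcases le_total x (T / 2) with hxm | hxm
    · exact hopen x hx _ ⟨by linarith, by linarith⟩ hxm
    · exact (hopen _ ⟨by linarith, by linarith⟩ x hx hxm).symm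
  refine ⟨?_, absolutelyContinuousOnInterval_of_dist_le (M := 1) hac ?_⟩
  · rw [ae_restrict_iff' measurableSet_Ioo]
    filter_upwards [hh.ae_hasDerivAt_integral] with t ht ht'
    have h1 := ht (by rw [uIcc_of_le hT.le]; exact Ioo_subset_Icc_self ht') 0 (by simp)
    refine (h1.add_const (G (T / 2) - ∫ v in 0..(T / 2), h v)).congr_of_eventuallyEq ?_
    filter_upwards [isOpen_Ioo.mem_nhds ht'] with s hs
    have := heq (Ioo_subset_Icc_self hs)
    simp only at this
    linarith
  · intro x hx y hy
    rw [uIcc_of_le hT.le] at hx hy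
    have h1 := heq hx
    have h2 := heq hy
    simp only at h1 h2
    rw [one_mul, Real.dist_eq, Real.dist_eq]
    refine le_of_eq (congrArg _ ?_)
    linarith

/-! ### Cutoff functions and finite measures. -/

theorem IsTest.exists_eq_one_on {V : Type*} [NormedAddCommGroup V] [NormedSpace ℝ V]
    [FiniteDimensional ℝ V] {U K : Set V} (hU : IsOpen U) (hK : IsCompact K) (hKU : K ⊆ U) :
    ∃ φ : V → ℝ, IsTest U φ ∧ (∀ x, φ x ∈ Icc (0 : ℝ) 1) ∧ ∀ x ∈ K, φ x = 1 := by
  -- A cutoff vanishing off the interior of an intermediate compact `L` has its closed support in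
  -- `L`, hence compact and inside `U`.
  obtain ⟨L, hL, hKL, hLU⟩ := exists_compact_between hK hU hKU
  obtain ⟨φ, h0, h1, hφ⟩ := exists_contMDiffMap_zero_one_of_isClosed (n := (⊤ : ℕ∞))
    (modelWithCornersSelf ℝ V) isOpen_interior.isClosed_compl hK.isClosed
    (disjoint_compl_left_iff_subset.2 hKL)
  have hts : tsupport φ ⊆ L := closure_minimal
    (fun x hx => by_contra fun hx' => hx (h0 fun h => hx' (interior_subset h))) hL.isClosed
  exact ⟨φ, ⟨φ.contMDiff.contDiff, hL.of_isClosed_subset (isClosed_tsupport _) hts,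
    hts.trans hLU⟩, hφ, h1⟩

/-- The indicator function of an open set is a bounded pointwise limit of test functions. -/
theorem IsTest.exists_tendsto_indicator {V : Type*} [NormedAddCommGroup V] [NormedSpace ℝ V]
    [FiniteDimensional ℝ V] {U : Set V} (hU : IsOpen U) :
    ∃ φ : ℕ → V → ℝ, (∀ n, IsTest U (φ n)) ∧ (∀ n x, φ n x ∈ Icc (0 : ℝ) 1) ∧
      ∀ x, Tendsto (fun n => φ n x) atTop (𝓝 (U.indicator (fun _ => 1) x)) := by
  obtain ⟨F, hFc, hFU, hFeq, hFm⟩ := hU.exists_iUnion_isClosed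
  -- The closed sets exhausting `U` may be unbounded; cutting with growing balls makes them compact,
  -- and every point of `U` still lies in all late ones.
  have hK : ∀ n : ℕ, IsCompact (F n ∩ Metric.closedBall (0 : V) n) := fun n =>
    (isCompact_closedBall _ _).inter_left (hFc n)
  choose φ h1 h2 h3 using fun n =>
    IsTest.exists_eq_one_on hU (hK n) (inter_subset_left.trans (hFU n))
  refine ⟨φ, h1, h2, fun x => ?_⟩
  by_cases hx : x ∈ U
  · rw [indicator_of_mem hx]
    refine tendsto_const_nhds.congr' ?_
    obtain ⟨m, hm⟩ := mem_iUnion.1 (hFeq ▸ hx)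
    obtain ⟨k, hk⟩ := exists_nat_ge ‖x‖
    filter_upwards [eventually_ge_atTop m, eventually_ge_atTop k] with n hn hn'
    refine (h3 n x ⟨hFm hn hm, ?_⟩).symm
    rw [mem_closedBall_zero_iff]
    exact hk.trans (by exact_mod_cast hn')
  · rw [indicator_of_notMem hx]
    refine tendsto_const_nhds.congr fun n => ((h1 n).eq_zero hx).symm

instance signedMeasure_isFiniteMeasure_variation {X : Type*} [MeasurableSpace X]
    (μ : SignedMeasure X) : IsFiniteMeasure μ.variation :=
  μ.totalVariation_eq_variation ▸ inferInstance

/-- The Euclidean norm is at most the sum of the absolute coordinates, so the variation is dominated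
by the sum of the variations of the finitely many scalar components. -/
instance isFiniteMeasure_variation_euclideanSpace {X ι : Type*} [MeasurableSpace X] [Fintype ι]
    (μ : VectorMeasure X (EuclideanSpace ℝ ι)) : IsFiniteMeasure μ.variation := by
  let c : ι → SignedMeasure X := fun i =>
    μ.mapRange (EuclideanSpace.proj (𝕜 := ℝ) i : EuclideanSpace ℝ ι →L[ℝ] ℝ).toLinearMap.toAddMonoidHom
      (EuclideanSpace.proj (𝕜 := ℝ) i : EuclideanSpace ℝ ι →L[ℝ] ℝ).continuous
  have hle : μ.variation ≤ ∑ i, (c i).variation := by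
    refine VectorMeasure.variation_le_of_forall_enorm_le fun E _ => ?_
    have h1 : ‖μ E‖ₑ ≤ ∑ i, ‖μ E i‖ₑ := by
      classical
      have h2 : ‖μ E‖ ≤ ∑ i, ‖μ E i‖ := by
        conv_lhs => rw [← (EuclideanSpace.basisFun ι ℝ).sum_repr (μ E)]
        refine (norm_sum_le _ _).trans (Finset.sum_le_sum fun i _ => ?_)
        rw [norm_smul]
        simp
      simp_rw [← ofReal_norm]
      rw [← ENNReal.ofReal_sum_of_nonneg fun i _ => norm_nonneg _]
      exact ENNReal.ofReal_le_ofReal h2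
    rw [Measure.finsetSum_apply]
    exact h1.trans (Finset.sum_le_sum fun i _ =>
      VectorMeasure.enorm_measure_le_variation (c i) E)
  exact isFiniteMeasure_of_le _ hle

variable {N : ℕ} {Ω : Set (Sp N)}

instance isFiniteMeasure_tv (v : Sp N → ℝ) : IsFiniteMeasure (tv Ω v) :=
  isFiniteMeasure_variation_euclideanSpace _

/-- Finite measures that agree on test functions have the same mass on the open set `Ω`. -/
theorem signedMeasure_apply_eq_of_forall_test (hΩ : IsOpen Ω) (μ : SignedMeasure (Sp N))
    (ν : Measure (Sp N)) [IsFiniteMeasure ν]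
    (h : ∀ ω : Sp N → ℝ, IsTest Ω ω → (∫ᵛ x, ω x ∂<•μ) = ∫ x, ω x ∂ν) :
    μ Ω = (ν Ω).toReal := by
  obtain ⟨φ, h1, h2, h3⟩ := IsTest.exists_tendsto_indicator hΩ
  have hb : ∀ n x, ‖φ n x‖ ≤ 1 := fun n x => by
    rw [Real.norm_of_nonneg (h2 n x).1]; exact (h2 n x).2
  have t1 : Tendsto (fun n => ∫ᵛ x, φ n x ∂<•μ) atTop
      (𝓝 (∫ᵛ x, Ω.indicator (fun _ => (1 : ℝ)) x ∂<•μ)) :=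
    VectorMeasure.tendsto_integral_filter_of_norm_le_const
      (Eventually.of_forall fun n => (h1 n).smooth.continuous.aestronglyMeasurable)
      ⟨1, Eventually.of_forall fun n => Eventually.of_forall fun x => hb n x⟩
      (Eventually.of_forall h3)
  have t2 : Tendsto (fun n => ∫ x, φ n x ∂ν) atTop
      (𝓝 (∫ x, Ω.indicator (fun _ => (1 : ℝ)) x ∂ν)) :=
    tendsto_integral_filter_of_norm_le_const
      (Eventually.of_forall fun n => (h1 n).smooth.continuous.aestronglyMeasurable)
      ⟨1, Eventually.of_forall fun n => Eventually.of_forall fun x => hb n x⟩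
      (Eventually.of_forall h3)
  simp_rw [fun n => h (φ n) (h1 n)] at t1
  have e := tendsto_nhds_unique t1 t2
  rw [VectorMeasure.integral_indicator_const _ hΩ.measurableSet,
    integral_indicator_const _ hΩ.measurableSet] at e
  simpa [Measure.real] using e

/-! ### The energy identity at a fixed time. -/

theorem InSign.mul_eq {s a : ℝ} (h : InSign s (-a)) : a * s = -|a| := by
  rcases lt_trichotomy a 0 with ha | rfl | ha
  · rw [h.1 (by linarith), abs_of_neg ha]; ring
  · simp
  · rw [h.2.1 (by linarith), abs_of_pos ha]; ring

/-- `s² = 1` wherever `a ≠ 0`. This recovers integrability of the trace `v` from that of `v [z, ν]`,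
the only integrability Green's formula supplies. -/
theorem InSign.mul_mul_eq {s a : ℝ} (h : InSign s (-a)) : a * s * s = a := by
  rcases lt_trichotomy a 0 with ha | rfl | ha
  · rw [h.1 (by linarith)]; ring
  · simp
  · rw [h.2.1 (by linarith)]; ring

/-- The energy identity at a fixed time: Green's formula for the pair of `v` and a field that
calibrates `v`. -/
theorem IsNormalTrace.div_apply_eq (hΩ : IsOpen Ω) {z : Sp N → Sp N} {d : (Sp N → ℝ) → ℝ}
    {g v : Sp N → ℝ} (hg : IsNormalTrace Ω z d g) (hv : IsBVL2 Ω v)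
    (hs : ∀ᵐ x ∂(surf Ω), InSign (g x) (- bvTrace Ω v x))
    (htv : ∀ ω : Sp N → ℝ, IsTest Ω ω → pairing Ω z d v ω = ∫ x, ω x ∂(tv Ω v)) :
    Integrable (bvTrace Ω v) (surf Ω) ∧
      d v = - (tv Ω v Ω).toReal - ∫ x, |bvTrace Ω v x| ∂(surf Ω) := by
  obtain ⟨μ, hμ, hi, hgreen⟩ := hg.green v hv
  -- The calibration is known only against test functions, whereas Green's formula involves the mass
  -- of all of `Ω`.
  have hmass : μ Ω = (tv Ω v Ω).toReal :=
    signedMeasure_apply_eq_of_forall_test hΩ μ _ fun ω hω => (hμ.repr ω hω).trans (htv ω hω)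
  have habs : ∫ x, bvTrace Ω v x * g x ∂(surf Ω) = - ∫ x, |bvTrace Ω v x| ∂(surf Ω) := by
    rw [← integral_neg]
    exact integral_congr_ae (hs.mono fun x hx => hx.mul_eq)
  refine ⟨?_, by linarith⟩
  refine (hi.mul_bdd (c := 1) hg.meas ?_).congr (hs.mono fun x hx => hx.mul_mul_eq)
  exact hg.bound

theorem IsFlux.ae_div_apply_eq (hΩ : IsOpen Ω) {T : ℝ} {u₀ : L2 Ω} {u : ℝ → L2 Ω}
    (hu : IsPath Ω T u₀ u) {z : ℝ → Sp N → Sp N} {d : ℝ → (Sp N → ℝ) → ℝ}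
    (hz : IsFlux Ω T u z d) :
    ∀ᵐ t ∂(volume.restrict (Ioo 0 T)), Integrable (bvTrace Ω (u t)) (surf Ω) ∧
      d t (u t) = - (tv Ω (u t) Ω).toReal - ∫ x, |bvTrace Ω (u t) x| ∂(surf Ω) := by
  filter_upwards [hu.bv, hz.trace, hz.eq_tv] with t h1 h2 h3
  obtain ⟨g, hg, hs⟩ := h2
  exact hg.div_apply_eq hΩ ⟨h1, Lp.memLp (u t)⟩ hs h3

/-! ### The chain rule for `½‖u‖²` in a Hilbert space. -/

section Hilbert

variable {E : Type*} [NormedAddCommGroup E] [InnerProductSpace ℝ E]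

/-- A path that is Lipschitz at `t` and has the weak derivative `p` there, tested on a dense set,
satisfies the chain rule for `½‖·‖²`. -/
theorem hasDerivAt_half_norm_sq_of_weak {u : ℝ → E} {p : E} {t : ℝ} {D : Set E} (hD : Dense D)
    (hw : ∀ v ∈ D, HasDerivAt (fun s => inner ℝ (u s) v) (inner ℝ p v) t)
    (hu : (fun s => u s - u t) =O[𝓝 t] fun s => s - t) :
    HasDerivAt (fun s => (1 / 2) * ‖u s‖ ^ 2) (inner ℝ p (u t)) t := by
  set r : ℝ → E := fun s => u s - u t - (s - t) • p with hr
  have hrO : r =O[𝓝 t] fun s => s - t := by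
    refine hu.sub (Asymptotics.IsBigO.of_bound ‖p‖ (Eventually.of_forall fun s => ?_))
    rw [norm_smul, mul_comm]
  have hrD : ∀ v ∈ D, (fun s => inner ℝ (r s) v) =o[𝓝 t] fun s => s - t := by
    intro v hv
    refine (hasDerivAt_iff_isLittleO.1 (hw v hv)).congr_left fun s => ?_
    simp only [hr, inner_sub_left, inner_smul_left, smul_eq_mul, conj_trivial]
  -- The vector `u t` need not lie in `D`. Replacing it by a nearby `v ∈ D` costs `‖r s‖ ‖u t - v‖`,
  -- at most `(ε / 2) |s - t|` because `r` is `O(s - t)`.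
  have hrx : (fun s => inner ℝ (r s) (u t)) =o[𝓝 t] fun s => s - t := by
    obtain ⟨C, hC, hb⟩ := hrO.exists_pos
    rw [Asymptotics.isLittleO_iff]
    intro ε hε
    obtain ⟨v, hv, hvd⟩ := hD.exists_dist_lt (u t) (show 0 < ε / (2 * C) by positivity)
    filter_upwards [hb.bound, Asymptotics.isLittleO_iff.1 (hrD v hv) (half_pos hε)] with s h1 h2
    have h3 : inner ℝ (r s) (u t) = inner ℝ (r s) v + inner ℝ (r s) (u t - v) := by
      rw [← inner_add_right, add_sub_cancel]
    have h4 : ‖inner ℝ (r s) (u t - v)‖ ≤ (C * ‖s - t‖) * (ε / (2 * C)) :=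
      (norm_inner_le_norm _ _).trans
        (mul_le_mul h1 (by rw [← dist_eq_norm]; exact hvd.le) (norm_nonneg _) (by positivity))
    have h5 : (C * ‖s - t‖) * (ε / (2 * C)) = ε / 2 * ‖s - t‖ := by field_simp
    rw [h3]
    refine (norm_add_le _ _).trans ?_
    linarith
  -- The quadratic term in the expansion of `½‖u s‖²` around `u t` is `O((s - t)²)`.
  have hsq : (fun s => (1 / 2) * ‖u s - u t‖ ^ 2) =o[𝓝 t] fun s => s - t := by
    refine Asymptotics.IsLittleO.const_mul_left ?_ _
    have h1 : (fun s => ‖u s - u t‖ ^ 2) =O[𝓝 t] fun s => (s - t) ^ 2 := hu.norm_left.pow 2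
    refine h1.trans_isLittleO ?_
    have h2 : (fun x : ℝ => x ^ 2) =o[𝓝 0] fun x => x := by
      simpa using Asymptotics.isLittleO_pow_pow (𝕜 := ℝ) (show 1 < 2 by norm_num)
    have h3 : Tendsto (fun s : ℝ => s - t) (𝓝 t) (𝓝 0) := by
      have : Tendsto (fun s : ℝ => s - t) (𝓝 t) (𝓝 (t - t)) := tendsto_id.sub_const t
      rwa [sub_self] at this
    exact h2.comp_tendsto h3
  rw [hasDerivAt_iff_isLittleO]
  refine (hrx.add hsq).congr_left fun s => ?_
  have e : u s = u t + (u s - u t) := by abel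
  have e2 : ‖u s‖ ^ 2 = ‖u t‖ ^ 2 + 2 * inner ℝ (u t) (u s - u t) + ‖u s - u t‖ ^ 2 := by
    conv_lhs => rw [e]
    exact norm_add_sq_real _ _
  simp only [hr, inner_sub_left, inner_smul_left, smul_eq_mul, conj_trivial]
  rw [e2, inner_sub_right, real_inner_comm]
  ring

variable [TopologicalSpace.SeparableSpace E]

/-- The chain rule `½‖u‖²' = ⟨u', u⟩` for a path in a separable Hilbert space with a weakly
integrable derivative of integrable norm. -/
theorem half_norm_sq_sub_eq_integral {u W : ℝ → E} {a b : ℝ} (hab : a ≤ b)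
    (hW : ∀ v, IntervalIntegrable (fun τ => inner ℝ (W τ) v) volume a b)
    (hn : IntervalIntegrable (fun τ => ‖W τ‖) volume a b)
    (hinc : ∀ s t, a ≤ s → s ≤ t → t ≤ b → ∀ v,
      inner ℝ (u t - u s) v = ∫ τ in s..t, inner ℝ (W τ) v) :
    IntervalIntegrable (fun τ => inner ℝ (W τ) (u τ)) volume a b ∧
      (1 / 2) * ‖u b‖ ^ 2 - (1 / 2) * ‖u a‖ ^ 2 = ∫ τ in a..b, inner ℝ (W τ) (u τ) := by
  set Φ : ℝ → ℝ := fun t => ∫ τ in a..t, ‖W τ‖ with hΦ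
  have hΦac : AbsolutelyContinuousOnInterval Φ a b :=
    hn.absolutelyContinuousOnInterval_intervalIntegral (by simp)
  have hsubint : ∀ {f : ℝ → ℝ}, IntervalIntegrable f volume a b → ∀ s t, a ≤ s → s ≤ t → t ≤ b →
      IntervalIntegrable f volume s t := fun {f} hf s t h1 h2 h3 =>
    hf.mono_set (by rw [uIcc_of_le h2, uIcc_of_le hab]; exact Icc_subset_Icc h1 h3)
  have hΦsub : ∀ s t, a ≤ s → s ≤ t → t ≤ b → Φ t - Φ s = ∫ τ in s..t, ‖W τ‖ := by
    intro s t h1 h2 h3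
    exact intervalIntegral.integral_interval_sub_left
      (hsubint hn a t le_rfl (h1.trans h2) h3) (hsubint hn a s le_rfl h1 (h2.trans h3))
  -- Testing the increment against itself gives `‖q‖² ≤ (Φ t - Φ s) ‖q‖`, so no Bochner integral of
  -- `W` is needed.
  have hle : ∀ s t, a ≤ s → s ≤ t → t ≤ b → ‖u t - u s‖ ≤ Φ t - Φ s := by
    intro s t h1 h2 h3
    set q := u t - u s with hq
    have hb : ‖q‖ ^ 2 ≤ (Φ t - Φ s) * ‖q‖ := by
      rw [← real_inner_self_eq_norm_sq, hq, hinc s t h1 h2 h3 q, hΦsub s t h1 h2 h3,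
        ← intervalIntegral.integral_mul_const]
      exact intervalIntegral.integral_mono_on h2 (hsubint (hW q) s t h1 h2 h3)
        ((hsubint hn s t h1 h2 h3).mul_const _) fun τ _ => real_inner_le_norm _ _
    have h0 : 0 ≤ Φ t - Φ s := by
      rw [hΦsub s t h1 h2 h3]
      exact intervalIntegral.integral_nonneg h2 fun _ _ => norm_nonneg _
    rcases (norm_nonneg q).eq_or_lt with hz | hpos
    · rw [← hz]; exact h0
    · nlinarith
  have hle' : ∀ s ∈ Icc a b, ∀ t ∈ Icc a b, ‖u s - u t‖ ≤ |Φ s - Φ t| := by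
    intro s hs t ht
    rcases le_total s t with h | h
    · rw [norm_sub_rev, abs_sub_comm]
      exact (hle s t hs.1 h ht.2).trans (le_abs_self _)
    · exact (hle t s ht.1 h hs.2).trans (le_abs_self _)
  set M := ‖u a‖ + Φ b with hM
  have hMb : ∀ t ∈ Icc a b, ‖u t‖ ≤ M := by
    intro t ht
    have h1 := hle a t le_rfl ht.1 ht.2
    have h2 := hle t b ht.1 ht.2 le_rfl
    have h3 : Φ a = 0 := by simp [hΦ]
    have h4 : ‖u t‖ ≤ ‖u a‖ + ‖u t - u a‖ := by
      simpa using norm_add_le (u a) (u t - u a)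
    have h5 := norm_nonneg (u b - u t)
    linarith
  have hac : AbsolutelyContinuousOnInterval (fun s => (1 / 2) * ‖u s‖ ^ 2) a b := by
    refine absolutelyContinuousOnInterval_of_dist_le (M := M) hΦac fun x hx y hy => ?_
    rw [uIcc_of_le hab] at hx hy
    have h1 := hMb x hx
    have h2 := hMb y hy
    have h3 := abs_norm_sub_norm_le (u x) (u y)
    have h4 := hle' x hx y hy
    rw [Real.dist_eq, Real.dist_eq, show (1 / 2) * ‖u x‖ ^ 2 - (1 / 2) * ‖u y‖ ^ 2 =
      ((‖u x‖ + ‖u y‖) / 2) * (‖u x‖ - ‖u y‖) by ring, abs_mul]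
    have h5 : |(‖u x‖ + ‖u y‖) / 2| ≤ M := by
      rw [abs_of_nonneg (by positivity)]
      linarith
    exact mul_le_mul h5 (h3.trans h4) (abs_nonneg _) ((abs_nonneg _).trans h5)
  -- Countability lets one null set of times serve all test vectors in `D`.
  obtain ⟨D, hDc, hDd⟩ := TopologicalSpace.exists_countable_dense E
  have hder : ∀ᵐ t, t ∈ Ioo a b →
      HasDerivAt (fun s => (1 / 2) * ‖u s‖ ^ 2) (inner ℝ (W t) (u t)) t := by
    have h1 : ∀ᵐ t, ∀ v ∈ D, t ∈ uIcc a b → ∀ c ∈ uIcc a b,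
        HasDerivAt (fun x => ∫ τ in c..x, inner ℝ (W τ) v) (inner ℝ (W t) v) t :=
      (ae_ball_iff hDc).2 fun v _ => (hW v).ae_hasDerivAt_integral
    filter_upwards [h1, hn.ae_hasDerivAt_integral] with t ht1 ht2 ht
    have htI : t ∈ uIcc a b := by rw [uIcc_of_le hab]; exact Ioo_subset_Icc_self ht
    have hnhds : Icc a b ∈ 𝓝 t := Icc_mem_nhds ht.1 ht.2
    refine hasDerivAt_half_norm_sq_of_weak hDd (fun v hv => ?_) ?_
    · refine ((ht1 v hv htI a (by simp)).add_const (inner ℝ (u a) v)).congr_of_eventuallyEq ?_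
      filter_upwards [hnhds] with s hs
      have := hinc a s le_rfl hs.1 hs.2 v
      rw [inner_sub_left] at this
      linarith
    -- Increments of `u` are bounded by those of `Φ`, so differentiability of `Φ` at `t` gives the
    -- Lipschitz bound there.
    · refine Asymptotics.IsBigO.trans ?_ (ht2 htI a (by simp)).isBigO_sub
      refine Asymptotics.IsBigO.of_bound 1 ?_
      filter_upwards [hnhds] with s hs
      rw [one_mul]
      exact hle' s hs t (Ioo_subset_Icc_self ht)
  have hcongr : ∀ᵐ t, t ∈ uIoc a b →
      deriv (fun s => (1 / 2) * ‖u s‖ ^ 2) t = inner ℝ (W t) (u t) := by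
    have hb : ∀ᵐ t : ℝ, t ≠ b := by simp [ae_iff, measure_singleton]
    filter_upwards [hder, hb] with t ht htb htI
    rw [uIoc_of_le hab] at htI
    exact (ht ⟨htI.1, lt_of_le_of_ne htI.2 htb⟩).deriv
  refine ⟨hac.intervalIntegrable_deriv.congr_ae ?_, ?_⟩
  · rwa [EventuallyEq, ae_restrict_iff' measurableSet_uIoc]
  · rw [← intervalIntegral.integral_congr_ae hcongr, hac.integral_deriv_eq_sub]

end Hilbert

/-! ### Time slices of square-integrable functions. -/

open Classical in
/-- The class in `L²` of a time slice, or `0` if the slice is not square-integrable. -/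
noncomputable def sliceL2 {X Y : Type*} [MeasurableSpace Y] (ν : Measure Y)
    (w : X → Y → ℝ) (t : X) : Lp ℝ 2 ν :=
  if h : MemLp (w t) 2 ν then h.toLp (w t) else 0

theorem sliceL2_inner {X Y : Type*} [MeasurableSpace Y] {ν : Measure Y} {w : X → Y → ℝ}
    {t : X} (h : MemLp (w t) 2 ν) (v : Lp ℝ 2 ν) :
    inner ℝ (sliceL2 ν w t) v = ∫ x, w t x * v x ∂ν := by
  rw [sliceL2, dif_pos h, L2.inner_def]
  refine integral_congr_ae ?_
  filter_upwards [h.coeFn_toLp] with x hx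
  rw [hx]
  simp [mul_comm]

theorem norm_sq_sliceL2 {X Y : Type*} [MeasurableSpace Y] {ν : Measure Y} {w : X → Y → ℝ}
    {t : X} (h : MemLp (w t) 2 ν) :
    ‖sliceL2 ν w t‖ ^ 2 = ∫ x, w t x ^ 2 ∂ν := by
  rw [← real_inner_self_eq_norm_sq, sliceL2_inner h]
  refine integral_congr_ae ?_
  rw [sliceL2, dif_pos h]
  filter_upwards [h.coeFn_toLp] with x hx
  rw [hx, sq]

section Slices

variable {X Y : Type*} [MeasurableSpace X] [MeasurableSpace Y] {σ : Measure X} {ν : Measure Y}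
  [IsFiniteMeasure σ] [IsFiniteMeasure ν] {w : X → Y → ℝ} {v : Y → ℝ}

theorem MemLp.ae_memLp_slice (hw : MemLp (Function.uncurry w) 2 (σ.prod ν)) :
    ∀ᵐ t ∂σ, MemLp (w t) 2 ν := by
  filter_upwards [hw.aestronglyMeasurable.prodMk_left, hw.integrable_sq.prod_right_ae]
    with t h1 h2
  exact (memLp_two_iff_integrable_sq h1).2 h2

theorem MemLp.integrable_mul_snd (hw : MemLp (Function.uncurry w) 2 (σ.prod ν))
    (hv : MemLp v 2 ν) : Integrable (Function.uncurry fun t x => w t x * v x) (σ.prod ν) :=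
  hw.integrable_mul (hv.comp_snd σ)

theorem integral_slice_mul_swap (hw : MemLp (Function.uncurry w) 2 (σ.prod ν))
    (hv : MemLp v 2 ν) :
    ∫ x, (∫ t, w t x ∂σ) * v x ∂ν = ∫ t, ∫ x, w t x * v x ∂ν ∂σ := by
  simp_rw [← integral_mul_const]
  exact (integral_integral_swap (MemLp.integrable_mul_snd hw hv)).symm

/-- Measurability comes from writing the norm as `√(∫ w²)`, measurable in `t` by Fubini, which
avoids measurability of the `L²`-valued map. The majorant is `1 + ‖·‖²`, integrable as `σ` is
finite. -/
theorem integrable_norm_sliceL2 (hw : MemLp (Function.uncurry w) 2 (σ.prod ν)) :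
    Integrable (fun t => ‖sliceL2 ν w t‖) σ := by
  have hi : Integrable (fun t => ∫ x, w t x ^ 2 ∂ν) σ := hw.integrable_sq.integral_prod_left
  have he : (fun t => ‖sliceL2 ν w t‖) =ᵐ[σ] fun t => √(∫ x, w t x ^ 2 ∂ν) := by
    filter_upwards [MemLp.ae_memLp_slice hw] with t ht
    rw [← norm_sq_sliceL2 ht, Real.sqrt_sq (norm_nonneg _)]
  refine ((integrable_const (1 : ℝ)).add hi).mono'
    ((Real.continuous_sqrt.comp_aestronglyMeasurable hi.aestronglyMeasurable).congr he.symm) ?_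
  filter_upwards [MemLp.ae_memLp_slice hw] with t ht
  have h1 := norm_sq_sliceL2 ht
  rw [norm_norm, Pi.add_apply, ← h1]
  nlinarith [sq_nonneg (‖sliceL2 ν w t‖ - 1), norm_nonneg (sliceL2 ν w t)]

theorem integrable_inner_sliceL2 (hw : MemLp (Function.uncurry w) 2 (σ.prod ν)) (v : Lp ℝ 2 ν) :
    Integrable (fun t => inner ℝ (sliceL2 ν w t) v) σ := by
  refine (MemLp.integrable_mul_snd hw (Lp.memLp v)).integral_prod_left.congr ?_
  filter_upwards [MemLp.ae_memLp_slice hw] with t ht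
  exact (sliceL2_inner ht v).symm

end Slices

theorem norm_sq_L2_eq {Y : Type*} [MeasurableSpace Y] {ν : Measure Y} (v : Lp ℝ 2 ν) :
    ‖v‖ ^ 2 = ∫ x, v x ^ 2 ∂ν := by
  rw [← real_inner_self_eq_norm_sq, L2.inner_def]
  simp [sq]

/-! ### Paths in `L²(Ω)` with a square-integrable time derivative. -/

theorem MemLp.restrict_cyl {w : ℝ → Sp N → ℝ} {a b s t : ℝ}
    (hw : MemLp (Function.uncurry w) 2 (cyl a b Ω)) (h : Ioc s t ⊆ Ioo a b) :
    MemLp (Function.uncurry w) 2 ((volume.restrict (Ioc s t)).prod (volume.restrict Ω)) :=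
  hw.mono_measure (by
    rw [cyl, Measure.prod_restrict, Measure.prod_restrict]
    exact Measure.restrict_mono (prod_mono h le_rfl) le_rfl)

/-- A continuous path in `L²(Ω)` with distributional derivative `w` is a weak primitive of `w`. -/
theorem inner_sub_eq_integral_of_weakDeriv (hΩ : IsOpen Ω)
    [IsFiniteMeasure (volume.restrict Ω : Measure (Sp N))] {T : ℝ} {u : ℝ → L2 Ω}
    (hu : ContinuousOn u (Ioo 0 T)) {w : ℝ → Sp N → ℝ}
    (H : ∀ (η : ℝ → ℝ) (ω : Sp N → ℝ), IsTest (Ioo 0 T) η → IsTest Ω ω →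
      ∫ t in Ioo 0 T, deriv η t * ∫ x in Ω, u t x * ω x =
        - ∫ t in Ioo 0 T, η t * ∫ x in Ω, w t x * ω x)
    {s t : ℝ} (hs : 0 < s) (hst : s ≤ t) (ht : t < T)
    (hw : MemLp (Function.uncurry w) 2
      ((volume.restrict (Ioc s t)).prod (volume.restrict Ω))) (v : L2 Ω) :
    inner ℝ (u t - u s) v = ∫ τ in Ioc s t, ∫ x in Ω, w τ x * v x := by
  have hqi : ∀ τ, Integrable (u τ) (volume.restrict Ω) := fun τ =>
    (Lp.memLp (u τ)).integrable (by norm_num)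
  have hwi : Integrable (fun x => ∫ τ in Ioc s t, w τ x) (volume.restrict Ω) :=
    (hw.integrable (by norm_num)).integral_prod_right
  have htest : ∀ ω, IsTest Ω ω → MemLp ω 2 (volume.restrict Ω) := fun ω hω =>
    (hω.smooth.continuous.memLp_of_hasCompactSupport hω.compact_supp).restrict Ω
  have hmul : ∀ (p : L2 Ω) {ω : Sp N → ℝ}, MemLp ω 2 (volume.restrict Ω) →
      Integrable (fun x => p x * ω x) (volume.restrict Ω) := fun p ω hω =>
    (Lp.memLp p).integrable_mul hω
  have hwmul : ∀ {ω : Sp N → ℝ}, MemLp ω 2 (volume.restrict Ω) →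
      Integrable (fun x => (∫ τ in Ioc s t, w τ x) * ω x) (volume.restrict Ω) := fun {ω} hω => by
    simp_rw [← integral_mul_const]
    exact (MemLp.integrable_mul_snd hw hω).integral_prod_right
  have hinc : ∀ ω, IsTest Ω ω → (∫ x in Ω, u t x * ω x) - (∫ x in Ω, u s x * ω x) =
      ∫ τ in Ioc s t, ∫ x in Ω, w τ x * ω x := by
    intro ω hω
    rw [← intervalIntegral.integral_of_le hst]
    refine sub_eq_integral_of_weakDeriv_Ioo (G := fun t => ∫ x in Ω, u t x * ω x)
      (h := fun τ => ∫ x in Ω, w τ x * ω x) ?_ hs hst ht ?_ fun η hη => H η ω hη hω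
    · have h1 : ∀ τ, ∫ x in Ω, u τ x * ω x = inner ℝ (u τ) ((htest ω hω).toLp ω) := by
        intro τ
        rw [L2.inner_def]
        refine integral_congr_ae ?_
        filter_upwards [(htest ω hω).coeFn_toLp] with x hx
        rw [hx]
        simp [mul_comm]
      simp_rw [h1]
      exact hu.inner continuousOn_const
    · rw [intervalIntegrable_iff_integrableOn_Ioc_of_le hst]
      exact (MemLp.integrable_mul_snd hw (htest ω hω)).integral_prod_left
  -- Identifying the increment pointwise a.e. in `x` allows pairing with arbitrary `v ∈ L²(Ω)`
  -- rather than test functions only.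
  have hae : ∀ᵐ x, x ∈ Ω → u t x - u s x - ∫ τ in Ioc s t, w τ x = 0 := by
    refine hΩ.ae_eq_zero_of_integral_contDiff_smul_eq_zero ?_ fun g h1 h2 h3 => ?_
    · exact IntegrableOn.locallyIntegrableOn (((hqi t).sub (hqi s)).sub hwi)
    · have hg : IsTest Ω g := ⟨h1, h2, h3⟩
      have e1 : ∫ x, g x • (u t x - u s x - ∫ τ in Ioc s t, w τ x) =
          ∫ x in Ω, (u t x * g x - u s x * g x - (∫ τ in Ioc s t, w τ x) * g x) := by
        rw [← setIntegral_eq_integral_of_forall_compl_eq_zero (s := Ω)]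
        · refine integral_congr_ae (Eventually.of_forall fun x => ?_)
          simp only [smul_eq_mul]
          ring
        · intro x hx
          rw [hg.eq_zero hx, zero_smul]
      have e2 : Integrable (fun x => u t x * g x - u s x * g x) (volume.restrict Ω) :=
        (hmul _ (htest g hg)).sub (hmul _ (htest g hg))
      rw [e1, integral_sub e2 (hwmul (htest g hg)),
        integral_sub (hmul _ (htest g hg)) (hmul _ (htest g hg)),
        hinc g hg, integral_slice_mul_swap hw (htest g hg), sub_self]
  rw [← integral_slice_mul_swap hw (Lp.memLp v), L2.inner_def]
  refine integral_congr_ae ?_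
  filter_upwards [Lp.coeFn_sub (u t) (u s), (ae_restrict_iff' hΩ.measurableSet).2 hae]
    with x h1 h2
  rw [h1, ← sub_eq_zero.1 h2]
  simp [mul_comm]

theorem half_integral_sq_sub_eq_of_weakDeriv (hΩ : IsOpen Ω)
    [IsFiniteMeasure (volume.restrict Ω : Measure (Sp N))] {T : ℝ} {u : ℝ → L2 Ω}
    (hu : ContinuousOn u (Ioo 0 T)) {w : ℝ → Sp N → ℝ}
    (hw : ∀ δ : ℝ, 0 < δ → MemLp (Function.uncurry w) 2 (cyl δ T Ω))
    (H : ∀ (η : ℝ → ℝ) (ω : Sp N → ℝ), IsTest (Ioo 0 T) η → IsTest Ω ω →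
      ∫ t in Ioo 0 T, deriv η t * ∫ x in Ω, u t x * ω x =
        - ∫ t in Ioo 0 T, η t * ∫ x in Ω, w t x * ω x)
    {a b : ℝ} (ha : 0 < a) (hab : a ≤ b) (hb : b < T) :
    IntervalIntegrable (fun τ => ∫ x in Ω, w τ x * u τ x) volume a b ∧
      (1 / 2) * (∫ x in Ω, u b x ^ 2) - (1 / 2) * (∫ x in Ω, u a x ^ 2) =
        ∫ τ in a..b, ∫ x in Ω, w τ x * u τ x := by
  have hwab : ∀ s t, a ≤ s → t ≤ b → MemLp (Function.uncurry w) 2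
      ((volume.restrict (Ioc s t)).prod (volume.restrict Ω)) := fun s t h1 h2 =>
    MemLp.restrict_cyl (hw a ha) fun x hx => ⟨h1.trans_lt hx.1, (hx.2.trans h2).trans_lt hb⟩
  have hm := MemLp.ae_memLp_slice (hwab a b le_rfl le_rfl)
  have : Fact ((2 : ℝ≥0∞) ≠ ∞) := ⟨by norm_num⟩
  obtain ⟨h1, h2⟩ := half_norm_sq_sub_eq_integral (u := u)
    (W := sliceL2 (volume.restrict Ω) w) hab
    (fun v => (intervalIntegrable_iff_integrableOn_Ioc_of_le hab).2
      (integrable_inner_sliceL2 (hwab a b le_rfl le_rfl) v))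
    ((intervalIntegrable_iff_integrableOn_Ioc_of_le hab).2
      (integrable_norm_sliceL2 (hwab a b le_rfl le_rfl)))
    (fun s t hs hst ht v => by
      rw [inner_sub_eq_integral_of_weakDeriv hΩ hu H (ha.trans_le hs) hst (ht.trans_lt hb)
        (hwab s t hs ht) v, intervalIntegral.integral_of_le hst]
      refine integral_congr_ae ?_
      filter_upwards [MemLp.ae_memLp_slice (hwab s t hs ht)] with τ hτ
      exact (sliceL2_inner hτ v).symm)
  have he : (fun τ => inner ℝ (sliceL2 (volume.restrict Ω) w τ) (u τ))
      =ᵐ[volume.restrict (Ioc a b)] fun τ => ∫ x in Ω, w τ x * u τ x :=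
    hm.mono fun τ hτ => sliceL2_inner hτ (u τ)
  rw [norm_sq_L2_eq, norm_sq_L2_eq] at h2
  refine ⟨h1.congr_ae (by rwa [uIoc_of_le hab]), ?_⟩
  rw [h2, intervalIntegral.integral_of_le hab, intervalIntegral.integral_of_le hab,
    integral_congr_ae he]

/-! ### The energy balance. -/

theorem integrable_mul_L2 (v : L2 Ω) {g : Sp N → ℝ} (hg : MemLp g 2 (volume.restrict Ω)) :
    IntegrableOn (fun x => v x * g x) Ω :=
  (Lp.memLp v).integrable_mul hg

theorem continuousOn_half_integral_sq {s : Set ℝ} {u : ℝ → L2 Ω} (hu : ContinuousOn u s) :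
    ContinuousOn (fun t => (1 / 2) * ∫ x in Ω, (u t x) ^ 2) s := by
  simp_rw [← norm_sq_L2_eq]
  exact continuousOn_const.mul (hu.norm.pow 2)

/-- The energy balance for a path with a flux, provided that `⟨⟨div z + f, u⟩⟩` is the derivative
of `½ ∫_Ω u²` in the integrated sense in the interior of the time interval. -/
theorem IsFlux.energy_balance (hΩ : IsOpen Ω)
    [IsFiniteMeasure (volume.restrict Ω : Measure (Sp N))] {T : ℝ} (hT : 0 < T)
    {f : ℝ → Sp N → ℝ} (hf : MemLp (Function.uncurry f) 2 (cyl 0 T Ω)) {u₀ : L2 Ω}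
    {u : ℝ → L2 Ω} (hu : IsPath Ω T u₀ u) {z : ℝ → Sp N → Sp N} {d : ℝ → (Sp N → ℝ) → ℝ}
    (hz : IsFlux Ω T u z d)
    (hint : ∀ a b, 0 < a → a ≤ b → b < T →
      IntervalIntegrable (fun t => dpair Ω (d t) (f t) (u t)) volume a b ∧
        (1 / 2) * (∫ x in Ω, (u b x) ^ 2) - (1 / 2) * (∫ x in Ω, (u a x) ^ 2) =
          ∫ t in a..b, dpair Ω (d t) (f t) (u t)) :
    (∀ᵐ t ∂(volume.restrict (Ioo 0 T)),
      tv Ω (u t) Ω < ∞ ∧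
      Integrable (bvTrace Ω (u t)) (surf Ω) ∧
      IntegrableOn (fun x => u t x * f t x) Ω ∧
      HasDerivAt (fun s => (1 / 2) * ∫ x in Ω, (u s x) ^ 2)
        (- (tv Ω (u t) Ω).toReal - (∫ x, |bvTrace Ω (u t) x| ∂(surf Ω))
          + ∫ x in Ω, u t x * f t x) t) ∧
    AbsolutelyContinuousOnInterval (fun t => ∫ x in Ω, (u t x) ^ 2) 0 T := by
  have hdiv := hz.ae_div_apply_eq hΩ hu
  have hfs : ∀ᵐ t ∂(volume.restrict (Ioo 0 T)), MemLp (f t) 2 (volume.restrict Ω) :=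
    MemLp.ae_memLp_slice hf
  have hGc := continuousOn_half_integral_sq hu.cont
  have hfi : IntegrableOn (fun t => ∫ x in Ω, f t x ^ 2) (Ioo 0 T) :=
    hf.integrable_sq.integral_prod_left
  have hk : IntegrableOn (fun t => (1 / 2) * (∫ x in Ω, (u t x) ^ 2) +
      (1 / 2) * ∫ x in Ω, f t x ^ 2) (Ioo 0 T) :=
    ((hGc.integrableOn_compact isCompact_Icc).mono_set Ioo_subset_Icc_self).add
      (hfi.const_mul _)
  -- The two dissipative terms are dropped and `∫ f u` is bounded by Young's inequality.
  obtain ⟨hder, hac⟩ := hasDerivAt_and_absolutelyContinuous_of_le hT hGc hk hint (by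
    filter_upwards [hdiv, hfs] with t h1 h2
    have h3 : 0 ≤ ∫ x, |bvTrace Ω (u t) x| ∂(surf Ω) := integral_nonneg fun x => abs_nonneg _
    have h4 : 0 ≤ (tv Ω (u t) Ω).toReal := ENNReal.toReal_nonneg
    have h5 : ∫ x in Ω, f t x * u t x ≤
        ∫ x in Ω, ((1 / 2) * (u t x) ^ 2 + (1 / 2) * f t x ^ 2) := by
      refine integral_mono (h2.integrable_mul (Lp.memLp (u t)))
        (((Lp.memLp (u t)).integrable_sq.const_mul _).add (h2.integrable_sq.const_mul _))
        fun x => ?_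
      simp only
      nlinarith [sq_nonneg (u t x - f t x)]
    rw [integral_add ((Lp.memLp (u t)).integrable_sq.const_mul _)
      (h2.integrable_sq.const_mul _), integral_const_mul, integral_const_mul] at h5
    simp only [dpair]
    rw [h1.2]
    linarith)
  refine ⟨?_, ?_⟩
  · filter_upwards [hdiv, hfs, hder] with t h1 h2 h3
    refine ⟨measure_lt_top _ _, h1.1, integrable_mul_L2 _ h2, ?_⟩
    simp only [dpair, h1.2] at h3
    simpa only [mul_comm (f t _)] using h3
  · have := hac.const_mul 2
    simpa using this

end TVFlow

theorem mainTheorem5 {N : ℕ} (hN : 2 ≤ N) (Ω : Set (TVFlow.Sp N)) (hΩo : IsOpen Ω)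
    (hΩb : Bornology.IsBounded Ω) (hΩL : TVFlow.HasLipschitzBoundary Ω)
    (T : ℝ) (hT : 0 < T) (f : ℝ → TVFlow.Sp N → ℝ)
    (hf : MemLp (Function.uncurry f) 2 (TVFlow.cyl 0 T Ω))
    (u₀ : TVFlow.L2 Ω) (u : ℝ → TVFlow.L2 Ω)
    (hu : TVFlow.IsSolution Ω T f u₀ u ∨ TVFlow.IsStrongSolution Ω T f u₀ u) :
    (∀ᵐ t ∂(volume.restrict (Ioo 0 T)),
      TVFlow.tv Ω (u t) Ω < ∞ ∧
      Integrable (TVFlow.bvTrace Ω (u t)) (TVFlow.surf Ω) ∧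
      IntegrableOn (fun x => u t x * f t x) Ω ∧
      HasDerivAt (fun s => (1 / 2) * ∫ x in Ω, (u s x) ^ 2)
        (- (TVFlow.tv Ω (u t) Ω).toReal - (∫ x, |TVFlow.bvTrace Ω (u t) x| ∂(TVFlow.surf Ω))
          + ∫ x in Ω, u t x * f t x) t) ∧
    AbsolutelyContinuousOnInterval (fun t => ∫ x in Ω, (u t x) ^ 2) 0 T := by
  have : IsFiniteMeasure (volume.restrict Ω : Measure (TVFlow.Sp N)) :=
    ⟨by simpa using hΩb.measure_lt_top⟩
  rcases hu with ⟨hP, z, d, -, hz, -, hloc, hweak⟩ | ⟨hP, z, w, hw, hweak, hz⟩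
  · refine hz.energy_balance hΩo hT hf hP fun a b ha hab hb => ?_
    have hi := TVFlow.LocallyIntegrableOn.intervalIntegrable_of_Ioo hloc ha hab hb
    refine ⟨hi, TVFlow.sub_eq_integral_of_weakDeriv_Ioo
      (G := fun t => (1 / 2) * ∫ x in Ω, (u t x) ^ 2)
      (TVFlow.continuousOn_half_integral_sq (hP.cont.mono Ioo_subset_Icc_self))
      ha hab hb hi fun η hη => ?_⟩
    rw [← hweak η hη, neg_neg]
  · refine hz.energy_balance hΩo hT hf hP fun a b ha hab hb => ?_
    obtain ⟨hi, he⟩ := TVFlow.half_integral_sq_sub_eq_of_weakDeriv hΩo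
      (hP.cont.mono Ioo_subset_Icc_self) hw hweak ha hab hb
    have hsub : Ioc a b ⊆ Ioo 0 T := fun x hx => ⟨ha.trans hx.1, hx.2.trans_lt hb⟩
    have hwb := TVFlow.MemLp.ae_memLp_slice (TVFlow.MemLp.restrict_cyl (hw a ha)
      fun x hx => ⟨hx.1, hx.2.trans_lt hb⟩ : MemLp (Function.uncurry w) 2
        ((volume.restrict (Ioc a b)).prod (volume.restrict Ω)))
    have hfb := TVFlow.MemLp.ae_memLp_slice (TVFlow.MemLp.restrict_cyl hf hsub)
    -- With `div z = u' - f` the source cancels: `(w - f) u + f u = w u`. The integral may be split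
    -- because almost every slice of `w` and `f` is in `L²(Ω)`.
    have hcongr : (fun τ => ∫ x in Ω, w τ x * u τ x) =ᵐ[volume.restrict (uIoc a b)]
        fun t => TVFlow.dpair Ω (fun v => ∫ x in Ω, (w t x - f t x) * v x) (f t) (u t) := by
      rw [uIoc_of_le hab]
      filter_upwards [hwb, hfb] with t h1 h2
      simp only [TVFlow.dpair]
      have e := integral_add ((h1.sub h2).integrable_mul (Lp.memLp (u t)))
        (h2.integrable_mul (Lp.memLp (u t)))
      refine (integral_congr_ae (Eventually.of_forall fun x => ?_)).trans e
      simp only [Pi.mul_apply, Pi.sub_apply]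
      ring
    refine ⟨hi.congr_ae hcongr, he.trans (intervalIntegral.integral_congr_ae ?_)⟩
    exact (ae_restrict_iff' measurableSet_uIoc).1 hcongr
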